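/- **Definitions.** Let $r,q\ge 1$ be integers and put $s=\lceil r/2\rceil$. Let $\mathcal N^r_q=\{\mathbf a=(a_1,\dots,a_q)\in\mathbb Z_{\ge0}^q : a_1+\dots+a_q=r\}$ and $B^r=\{\mathbf a\in\mathcal N^r_q : a_i\le s \text{ for all } i\}$. For $i\in\{1,\dots,q\}$ let $$F^r_i=\{\mathbf a\in\mathcal N^r_q : a_i\le\max\{r-1,s\},\ a_j\le s\text{ for } j\ne i\},\qquad G^r_i=\{\mathbf a\in\mathcal N^r_q : a_i\ge r-1\}.$$ Let $\mathbb L^r_q$ be the simplicial complex on the vertex set $\mathcal N^r_q$ whose faces are all subsets of the sets $F^r_1,\dots,F^r_q,G^r_1,\dots,G^r_q$; it depends only on $r$ and $q$. Let $S=\mathsf k[x_1,\dots,x_n]$ be a polynomial ring over a field $\mathsf k$ and let $I\subseteq S$ be an ideal minimally generated by monomials $m_1,\dots,m_q$. Put $\mathbf m^{\mathbf a}=m_1^{a_1}\cdots m_q^{a_q}$ for $\mathbf a\in\mathcal N^r_q$. Choose one representative from each class of the equivalence relation $\mathbf a\sim\mathbf b\iff \mathbf m^{\mathbf a}=\mathbf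 m^{\mathbf b}$ on $\mathcal N^r_q$, where a class that meets $B^r$ must be represented by an element of $B^r$. From the resulting set $\{\mathbf c_1,\dots,\mathbf c_t\}$ eliminate every $\mathbf c_i$ for which $\mathbf m^{\mathbf c_j}\mid\mathbf m^{\mathbf c_i}$ for some $j\ne i$. Then $\mathbb L^r(I)$ denotes the induced subcomplex of $\mathbb L^r_q$ on the set of remaining points (for some such choice of representatives). Let $\Delta$ be a finite simplicial complex whose vertices $v$ are labeled by monomials $M_v$ of $S$ and are totally ordered. For a face $\sigma$ let $M_\sigma=\mathrm{lcm}(M_v : v\in\sigma)$. For $t\ge0$ let $(\mathbb F_\Delta)_t$ be the free $S$-module with basis elements $e_\sigma$ in multidegree $M_\sigma$, for the faces $\sigma$ of $\Delta$ with $t+1$ vertices; for a face $\sigma=\{v_0<\dots<v_t\}$ with $t\ge1$ put $$\partial(e_\sigma)=\sum_{j=0}^t(-1)^j\,\frac{M_\sigma}{M_{\sigma\setminus\{v_j\}}}\,e_{\sigma\setminus\{v_j\}},$$ and let $(\mathbb F_\Delta)_0\to S$ map $e_{\{v\}}$ to $M_v$. One says that $\Delta$ *supports a free resolution* of an ideal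 $J$ of $S$ if this is a multigraded free resolution of $J$, that is, if the maps preserve multidegrees, the image of $(\mathbb F_\Delta)_0\to S$ is $J$, and the sequence $\cdots\to(\mathbb F_\Delta)_1\to(\mathbb F_\Delta)_0\to J\to0$ is exact. **Theorem.** Let $q\ge1$, let $I$ be an ideal of $S$ minimally generated by square-free monomials $m_1,\dots,m_q$, and let $r\ge1$. Label each vertex $\mathbf a$ of the complexes below with the monomial $\mathbf m^{\mathbf a}$, and fix any total order on $\mathcal N^r_q$. Then: 1. $\mathbb L^r_q$ supports a free resolution of $I^r$; 2. $\mathbb L^r(I)$ supports a free resolution of $I^r$, for every choice of representatives in its construction. -/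

import Mathlib

namespace PowerResolution

open MvPolynomial

noncomputable section

/-! ### Free resolutions -/

/-- The complex `⋯ → F 2 → F 1 → F 0 → I → 0` is a free resolution of the ideal `I` of `S`:
all `F t` are free of finite rank, only finitely many of them are nonzero, and the sequence is
exact.  The augmentation `ε` is written as a map to `S`, whose image is required to be `I`. -/
structure IsFreeResolution {S : Type*} [CommRing S] (I : Ideal S)
    (F : ℕ → Type*) [∀ t, AddCommGroup (F t)] [∀ t, Module S (F t)]
    (d : ∀ t, F (t + 1) →ₗ[S] F t) (ε : F 0 →ₗ[S] S) : Prop where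
  free : ∀ t, Module.Free S (F t)
  finite : ∀ t, Module.Finite S (F t)
  bounded : ∃ N, ∀ t, N ≤ t → Subsingleton (F t)
  exact_succ : ∀ t, Function.Exact (d (t + 1)) (d t)
  exact_zero : Function.Exact (d 0) ε
  range_eq : LinearMap.range ε = I

/-! ### Monomials

The monomial `x₁ ^ w₁ ⋯ xₙ ^ wₙ` is represented by its exponent vector `w : Fin n →₀ ℕ`.  For
exponent vectors `v` and `w`: the monomial of `v` divides the one of `w` iff `v ≤ w`, the lcm of
the two monomials has exponent vector `v ⊔ w`, and, if `v ≤ w`, the quotient of the second one by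
the first one has exponent vector `w - v`. -/

/-- The polynomial `x ^ w`. -/
def mono (k : Type*) [Field k] {n : ℕ} (w : Fin n →₀ ℕ) : MvPolynomial (Fin n) k :=
  monomial w 1

/-- The monomial with exponent vector `w` is square-free: no variable divides it twice. -/
def IsSquarefreeMonomial {n : ℕ} (w : Fin n →₀ ℕ) : Prop :=
  ∀ x, w x ≤ 1

/-- The family `g` generates `I` and no proper subfamily does. -/
def IsMinimallyGeneratedBy {S ι : Type*} [CommRing S] (I : Ideal S) (g : ι → S) : Prop :=
  Ideal.span (Set.range g) = I ∧ ∀ J : Set ι, Ideal.span (g '' J) = I → J = Set.univ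

/-! ### The homogenized chain complex of a labelled simplicial complex -/

section Homogenization

variable (k : Type*) [Field k] {n : ℕ} {V : Type*}

/-- The label `M_σ` of a face: the lcm of the labels of its vertices. -/
def faceLabel (label : V → (Fin n →₀ ℕ)) (σ : Finset V) : Fin n →₀ ℕ :=
  σ.sup label

/-- The faces of dimension `t`, that is, with `t + 1` vertices. -/
abbrev FaceOfDim (Δ : PreAbstractSimplicialComplex V) (t : ℕ) : Type _ :=
  {σ : Finset V // σ ∈ Δ.faces ∧ σ.card = t + 1}

/-- The free module over `k[x₁, …, xₙ]` with basis `e_σ`, where `σ` runs over the faces with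
`t + 1` vertices. -/
abbrev Chains (n : ℕ) (Δ : PreAbstractSimplicialComplex V) (t : ℕ) : Type _ :=
  FaceOfDim Δ t →₀ MvPolynomial (Fin n) k

/-- An element `∑ f_σ e_σ` is homogeneous of multidegree `w`, where `e_σ` has multidegree
`M_σ`. -/
def IsMultihomogeneous {Δ : PreAbstractSimplicialComplex V} {t : ℕ}
    (label : V → (Fin n →₀ ℕ)) (w : Fin n →₀ ℕ) (f : Chains k n Δ t) : Prop :=
  ∀ σ, ∀ e ∈ (f σ).support, e + faceLabel label σ.1 = w

variable [LinearOrder V]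

/-- The facet of the face `σ` that is opposite to its vertex `v`. -/
def FaceOfDim.erase {Δ : PreAbstractSimplicialComplex V} {t : ℕ} (σ : FaceOfDim Δ (t + 1)) (v : V)
    (hv : v ∈ σ.1) : FaceOfDim Δ t :=
  ⟨σ.1.erase v, by
    have hc : (σ.1.erase v).card = t + 1 := by
      rw [Finset.card_erase_of_mem hv, σ.2.2]; rfl
    exact ⟨(Δ.isRelLowerSet_faces σ.2.1).2 (Finset.erase_subset v σ.1)
      (Finset.card_pos.mp (by omega)), hc⟩⟩

/-- The differential `∂ e_σ = ∑ⱼ (-1) ^ j (M_σ / M_{σ \ vⱼ}) e_{σ \ vⱼ}`, where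
`σ = {v₀ < v₁ < ⋯}`; the position `j` of `v` in `σ` is the number of vertices of `σ` that are
smaller than `v`. -/
def differential (Δ : PreAbstractSimplicialComplex V) (label : V → (Fin n →₀ ℕ)) (t : ℕ) :
    Chains k n Δ (t + 1) →ₗ[MvPolynomial (Fin n) k] Chains k n Δ t :=
  Finsupp.linearCombination (MvPolynomial (Fin n) k) fun σ =>
    ∑ v ∈ σ.1.attach,
      Finsupp.single (σ.erase v.1 v.2)
        ((-1) ^ (σ.1.filter (· < v.1)).card *
          mono k (faceLabel label σ.1 - faceLabel label (σ.1.erase v.1)))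

/-- The augmentation, which sends `e_v` to the monomial that labels the vertex `v`. -/
def augmentation (Δ : PreAbstractSimplicialComplex V) (label : V → (Fin n →₀ ℕ)) :
    Chains k n Δ 0 →ₗ[MvPolynomial (Fin n) k] MvPolynomial (Fin n) k :=
  Finsupp.linearCombination (MvPolynomial (Fin n) k) fun σ => mono k (faceLabel label σ.1)

/-- The simplicial complex `Δ`, whose vertices are labelled by monomials, supports a free
resolution of `I`: the homogenization of its chain complex is a multigraded free resolution
of `I`. -/
structure SupportsFreeResolution (Δ : PreAbstractSimplicialComplex V)
    (label : V → (Fin n →₀ ℕ)) (I : Ideal (MvPolynomial (Fin n) k)) : Prop where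
  isFreeResolution :
    IsFreeResolution I (Chains k n Δ) (differential k Δ label) (augmentation k Δ label)
  differential_homogeneous : ∀ (t : ℕ) (w : Fin n →₀ ℕ) (f : Chains k n Δ (t + 1)),
    IsMultihomogeneous k label w f → IsMultihomogeneous k label w (differential k Δ label t f)
  augmentation_homogeneous : ∀ (w : Fin n →₀ ℕ) (f : Chains k n Δ 0),
    IsMultihomogeneous k label w f → ∀ e ∈ (augmentation k Δ label f).support, e = w

end Homogenization

/-! ### The simplicial complexes -/

/-- The set of all `(a₁, …, a_q)` with nonnegative integers `aᵢ` whose sum is `r`. -/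
@[ext]
structure Points (r q : ℕ) : Type where
  coord : Fin q → ℕ
  sum_coord : ∑ i, coord i = r

/-- `s = ⌈r / 2⌉`. -/
def half (r : ℕ) : ℕ := (r + 1) / 2

/-- `Fᵢ`: the points with `aᵢ ≤ max (r - 1) s` and `aⱼ ≤ s` for `j ≠ i`. -/
def firstLayer (r q : ℕ) (i : Fin q) : Set (Points r q) :=
  {a | a.coord i ≤ max (r - 1) (half r) ∧ ∀ j, j ≠ i → a.coord j ≤ half r}

/-- `Gᵢ`: the points with `aᵢ ≥ r - 1`. -/
def secondLayer (r q : ℕ) (i : Fin q) : Set (Points r q) :=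
  {a | r - 1 ≤ a.coord i}

/-- `B`: the points with all coordinates at most `s`. -/
def base (r q : ℕ) : Set (Points r q) :=
  {a | ∀ i, a.coord i ≤ half r}

/-- The complex `𝕃 r q`, whose faces are the subsets of the sets `Fᵢ` and `Gᵢ`. -/
def complexL (r q : ℕ) : PreAbstractSimplicialComplex (Points r q) where
  faces := {σ | σ.Nonempty ∧
    ∃ i, (σ : Set (Points r q)) ⊆ firstLayer r q i ∨ (σ : Set (Points r q)) ⊆ secondLayer r q i}
  isRelLowerSet_faces := by
    rintro σ ⟨hσ, i, h⟩
    refine ⟨hσ, fun τ hτ hne => ⟨hne, i, ?_⟩⟩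
    have hτ' : (τ : Set (Points r q)) ⊆ σ := Finset.coe_subset.mpr hτ
    exact h.imp hτ'.trans hτ'.trans

/-- The induced subcomplex of `Δ` on the vertex set `W`. -/
def inducedSubcomplex {V : Type*} (Δ : PreAbstractSimplicialComplex V) (W : Set V) :
    PreAbstractSimplicialComplex V where
  faces := {σ | σ ∈ Δ.faces ∧ (σ : Set V) ⊆ W}
  isRelLowerSet_faces := by
    rintro σ ⟨hσ, h⟩
    have hΔ := Δ.isRelLowerSet_faces hσ
    exact ⟨hΔ.1, fun τ hτ hne => ⟨hΔ.2 hτ hne, (Finset.coe_subset.mpr hτ).trans h⟩⟩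

section Labels

variable {n q r : ℕ}

/-- The exponent vector of the monomial `m ^ a = m₁ ^ a₁ ⋯ m_q ^ a_q`. -/
def powerLabel (m : Fin q → (Fin n →₀ ℕ)) (a : Points r q) : Fin n →₀ ℕ :=
  ∑ i, a.coord i • m i

/-- `C` consists of one representative of each class of the relation `m ^ a = m ^ b`, and a class
that meets the base is represented by a point of the base. -/
structure IsRepresentativeSet (m : Fin q → (Fin n →₀ ℕ)) (C : Set (Points r q)) : Prop where
  existsUnique : ∀ a : Points r q, ∃! c, c ∈ C ∧ powerLabel m c = powerLabel m a
  mem_base : ∀ c ∈ C, (∃ b ∈ base r q, powerLabel m b = powerLabel m c) → c ∈ base r q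

/-- The points of `C` that remain after eliminating each `c` such that `m ^ c'` divides `m ^ c`
for some other point `c'` of `C`. -/
def nonredundant (m : Fin q → (Fin n →₀ ℕ)) (C : Set (Points r q)) : Set (Points r q) :=
  {c | c ∈ C ∧ ¬ ∃ c' ∈ C, c' ≠ c ∧ powerLabel m c' ≤ powerLabel m c}

/-- The complex `𝕃 r (I)`, where `I` is minimally generated by the monomials `m`, formed with the
set `C` of representatives. -/
def complexLOf (m : Fin q → (Fin n →₀ ℕ)) (C : Set (Points r q)) :
    PreAbstractSimplicialComplex (Points r q) :=
  inducedSubcomplex (complexL r q) (nonredundant m C)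

/-- A choice of representatives is always possible. -/
theorem exists_isRepresentativeSet (m : Fin q → (Fin n →₀ ℕ)) :
    ∃ C : Set (Points r q), IsRepresentativeSet m C := by
  classical
  have key : ∀ w : Set.range (powerLabel (r := r) m), ∃ c : Points r q, powerLabel m c = w.1 ∧
      ((∃ b ∈ base r q, powerLabel m b = w.1) → c ∈ base r q) := by
    rintro ⟨w, a, rfl⟩
    by_cases h : ∃ b ∈ base r q, powerLabel m b = powerLabel m a
    · obtain ⟨b, hb, hba⟩ := h
      exact ⟨b, hba, fun _ => hb⟩
    · exact ⟨a, rfl, fun h' => absurd h' h⟩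
  choose f hf hfb using key
  refine ⟨Set.range f, fun a => ⟨f ⟨_, a, rfl⟩, ⟨⟨_, rfl⟩, hf _⟩, ?_⟩, ?_⟩
  · rintro _ ⟨⟨w, rfl⟩, h⟩
    have : w = ⟨powerLabel m a, a, rfl⟩ := Subtype.ext ((hf w).symm.trans h)
    rw [this]
  · rintro _ ⟨w, rfl⟩ h
    exact hfb w (by rwa [hf w] at h)

end Labels

end

end PowerResolution

/-!
In multidegree `w`, the homogenized chain complex of a labelled simplicial complex is the augmented
chain complex of the induced subcomplex on the vertices whose label divides `x ^ w`. Hence it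
suffices that these subcomplexes of `𝕃 r q` are acyclic, and this holds for the induced subcomplex
on any set `N` of points whose labels generate `I ^ r`.

A vertex `r eᵢ` lies in no `Fⱼ`, so all faces through it are contained in `Gᵢ`. If it is not the
only point of `N` below `w`, then there is another one in `Gᵢ`, and `r eᵢ` can be removed without
changing the homology. The complex that remains is a cone over any point of `B`. If there is no
such point, then all its vertices lie in the same `Fᵢ`, and it is a simplex.

The points of `N` that this requires are found by moving units from one coordinate to another: since
the generators are square-free and none divides another, such an exchange decreases the lcm of two
labels, so it can be repeated only finitely often.
-/

namespace PowerResolution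

open Finset MvPolynomial
open scoped Pointwise

section Chains

variable {V : Type*} [LinearOrder V]

/-- The sign `(-1) ^ j`, where `j` is the number of elements of `σ` below `v`.  It is the
coefficient of the facet opposite to `v` in the boundary of a simplex `σ ∋ v`. -/
def vertexSign (v : V) (σ : Finset V) : ℤˣ :=
  (-1) ^ #{x ∈ σ | x < v}

theorem vertexSign_insert {u : V} {σ : Finset V} (hu : u ∉ σ) (v : V) :
    vertexSign v (insert u σ) = (if u < v then -1 else 1) * vertexSign v σ := by
  rw [vertexSign, vertexSign, filter_insert]
  split_ifs
  · rw [card_insert_of_notMem (by simp [hu]), pow_succ']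
  · rw [one_mul]

theorem vertexSign_erase {u : V} {σ : Finset V} (hu : u ∈ σ) (v : V) :
    vertexSign v (σ.erase u) = (if u < v then -1 else 1) * vertexSign v σ := by
  conv_rhs => rw [← insert_erase hu, vertexSign_insert (notMem_erase u σ)]
  split_ifs <;> simp

theorem vertexSign_mul_vertexSign_erase {u v : V} {σ : Finset V} (hu : u ∈ σ) (hv : v ∈ σ)
    (huv : u ≠ v) :
    vertexSign u σ * vertexSign v (σ.erase u) = -(vertexSign v σ * vertexSign u (σ.erase v)) := by
  rw [vertexSign_erase hu, vertexSign_erase hv]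
  rcases huv.lt_or_gt with h | h <;> simp [h, h.not_gt, mul_comm]

theorem vertexSign_mul_vertexSign_insert {u v : V} {σ : Finset V} (hu : u ∉ σ) (hv : v ∈ σ) :
    vertexSign u σ * vertexSign v (insert u σ) = -(vertexSign v σ * vertexSign u (σ.erase v)) := by
  rw [vertexSign_insert hu, vertexSign_erase hv]
  rcases (ne_of_mem_of_not_mem hv hu).lt_or_gt with h | h <;> simp [h, h.not_gt, mul_comm]

variable {A : Type*} [AddCommGroup A]

/-- The boundary operator of the augmented chain complex, with coefficients in `A`, of the full
simplex on `V`.  Chains of all dimensions are treated together; `∅` spans those of dimension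
`-1`. -/
noncomputable def boundary : (Finset V →₀ A) →+ (Finset V →₀ A) :=
  Finsupp.liftAddHom fun σ => ∑ v ∈ σ, vertexSign v σ • Finsupp.singleAddHom (σ.erase v)

theorem boundary_single (σ : Finset V) (a : A) :
    boundary (Finsupp.single σ a) = ∑ v ∈ σ, vertexSign v σ • Finsupp.single (σ.erase v) a := by
  simp [boundary]

theorem exists_of_mem_support_boundary {f : Finset V →₀ A} {τ : Finset V}
    (hτ : τ ∈ (boundary f).support) : ∃ σ ∈ f.support, ∃ v ∈ σ, σ.erase v = τ := by
  classical
  rw [boundary, Finsupp.liftAddHom_apply] at hτ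
  obtain ⟨σ, hσ, hστ⟩ := mem_biUnion.mp (Finsupp.support_sum hτ)
  simp only [AddMonoidHom.finsetSum_apply] at hστ
  obtain ⟨v, hv, hvτ⟩ := mem_biUnion.mp (Finsupp.support_finsetSum hστ)
  have := Finsupp.support_single_subset (Finsupp.support_smul hvτ)
  exact ⟨σ, hσ, v, hv, (mem_singleton.mp this).symm⟩

theorem boundary_boundary (f : Finset V →₀ A) : boundary (boundary f) = 0 := by
  induction f using Finsupp.induction_linear with
  | zero => simp
  | add f g hf hg => rw [map_add, map_add, hf, hg, add_zero]
  | single σ a =>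
    have expand : boundary (boundary (Finsupp.single σ a)) = ∑ p ∈ σ.sigma fun v => σ.erase v,
        (vertexSign p.1 σ * vertexSign p.2 (σ.erase p.1)) •
          Finsupp.single ((σ.erase p.1).erase p.2) a := by
      simp only [boundary_single, map_sum, Units.smul_def, map_zsmul, smul_sum, sum_sigma,
        mul_smul]
    rw [expand]
    refine sum_involution (fun p _ => ⟨p.2, p.1⟩) ?_ ?_ ?_ fun _ _ => rfl
    · rintro ⟨u, v⟩ h
      obtain ⟨hu, hvu, hv⟩ : u ∈ σ ∧ v ≠ u ∧ v ∈ σ := by simpa using h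
      rw [vertexSign_mul_vertexSign_erase hu hv hvu.symm, erase_right_comm, Units.neg_smul,
        neg_add_cancel]
    · rintro ⟨u, v⟩ h - heq
      exact (mem_erase.mp (mem_sigma.mp h).2).1 (congrArg Sigma.fst heq)
    · rintro ⟨u, v⟩ h
      simp only [mem_sigma, mem_erase] at h ⊢
      exact ⟨h.2.2, h.2.1.symm, h.1⟩

theorem boundary_mapRange {B : Type*} [AddCommGroup B] (φ : A →+ B) (f : Finset V →₀ A) :
    boundary (Finsupp.mapRange.addMonoidHom φ f) =
      Finsupp.mapRange.addMonoidHom φ (boundary f) := by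
  induction f using Finsupp.induction_linear with
  | zero => simp
  | add f g hf hg => simp only [map_add, hf, hg]
  | single σ a => simp [boundary_single, Units.smul_def, map_zsmul]

theorem boundary_filter_card (t : ℕ) (f : Finset V →₀ A) :
    boundary (f.filter (#· = t + 1)) = (boundary f).filter (#· = t) := by
  induction f using Finsupp.induction_linear with
  | zero => rw [Finsupp.filter_zero, map_zero, Finsupp.filter_zero]
  | add f g hf hg => simp only [Finsupp.filter_add, map_add, hf, hg]
  | single σ a =>
    have card_facet : ∀ v ∈ σ, #(σ.erase v) = t ↔ #σ = t + 1 := fun v hv => by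
      rw [← card_erase_add_one hv, add_left_inj]
    rw [boundary_single, Finsupp.filter_sum]
    by_cases hσ : #σ = t + 1
    · rw [Finsupp.filter_single_of_pos (#· = t + 1) hσ, boundary_single]
      refine sum_congr rfl fun v hv => ?_
      rw [Finsupp.filter_smul, Finsupp.filter_single_of_pos (#· = t) ((card_facet v hv).mpr hσ)]
    · rw [Finsupp.filter_single_of_neg (#· = t + 1) hσ, map_zero]
      refine (sum_eq_zero fun v hv => ?_).symm
      rw [Finsupp.filter_smul, Finsupp.filter_single_of_neg (#· = t) (mt (card_facet v hv).mp hσ),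
        smul_zero]

/-- The cone operator with apex `u`, a contracting homotopy of the full simplex. -/
noncomputable def cone (u : V) : (Finset V →₀ A) →+ (Finset V →₀ A) :=
  Finsupp.liftAddHom fun σ =>
    if u ∈ σ then 0 else vertexSign u σ • Finsupp.singleAddHom (insert u σ)

theorem cone_single_of_mem {u : V} {σ : Finset V} (hu : u ∈ σ) (a : A) :
    cone u (Finsupp.single σ a) = 0 := by
  simp [cone, hu]

theorem cone_single_of_notMem {u : V} {σ : Finset V} (hu : u ∉ σ) (a : A) :
    cone u (Finsupp.single σ a) = vertexSign u σ • Finsupp.single (insert u σ) a := by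
  simp [cone, hu]

theorem exists_of_mem_support_cone {u : V} {f : Finset V →₀ A} {τ : Finset V}
    (hτ : τ ∈ (cone u f).support) : ∃ σ ∈ f.support, insert u σ = τ := by
  classical
  rw [cone, Finsupp.liftAddHom_apply] at hτ
  obtain ⟨σ, hσ, hστ⟩ := mem_biUnion.mp (Finsupp.support_sum hτ)
  split_ifs at hστ with hu
  · simp at hστ
  · have := Finsupp.support_single_subset (Finsupp.support_smul hστ)
    exact ⟨σ, hσ, (mem_singleton.mp this).symm⟩

theorem boundary_cone_add_cone_boundary (u : V) (f : Finset V →₀ A) :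
    boundary (cone u f) + cone u (boundary f) = f := by
  induction f using Finsupp.induction_linear with
  | zero => simp
  | add f g hf hg =>
    conv_rhs => rw [← hf, ← hg]
    simp only [map_add]
    abel
  | single σ a =>
    have cone_boundary : cone u (boundary (Finsupp.single σ a)) =
        ∑ v ∈ σ, vertexSign v σ • cone u (Finsupp.single (σ.erase v) a) := by
      simp only [boundary_single, map_sum, Units.smul_def, map_zsmul]
    by_cases hu : u ∈ σ
    · rw [cone_single_of_mem hu, map_zero, zero_add, cone_boundary, sum_eq_single_of_mem u hu]
      · rw [cone_single_of_notMem (notMem_erase u σ), insert_erase hu, vertexSign_erase hu,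
          if_neg (lt_irrefl u), one_mul, smul_smul, Int.units_mul_self, one_smul]
      · intro v _ hvu
        rw [cone_single_of_mem (mem_erase.mpr ⟨hvu.symm, hu⟩), smul_zero]
    · have boundary_cone : boundary (cone u (Finsupp.single σ a)) = Finsupp.single σ a +
          ∑ v ∈ σ, (vertexSign u σ * vertexSign v (insert u σ)) •
            Finsupp.single ((insert u σ).erase v) a := by
        rw [cone_single_of_notMem hu, Units.smul_def, map_zsmul, ← Units.smul_def,
          boundary_single, sum_insert hu, smul_add, erase_insert hu, vertexSign_insert hu,
          if_neg (lt_irrefl u), one_mul, smul_smul, Int.units_mul_self, one_smul, smul_sum]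
        simp only [smul_smul]
      rw [boundary_cone, cone_boundary, add_assoc, ← sum_add_distrib, sum_eq_zero, add_zero]
      intro v hv
      have huv : u ≠ v := (ne_of_mem_of_not_mem hv hu).symm
      rw [cone_single_of_notMem (fun h => hu (mem_of_mem_erase h)), smul_smul,
        vertexSign_mul_vertexSign_insert hu hv, erase_insert_of_ne huv, Units.neg_smul,
        neg_add_cancel]

end Chains

section Acyclicity

variable {V : Type*} [LinearOrder V] {A : Type*} [AddCommGroup A]

/-- The augmented chain complex with coefficients in `A` of a family `K` of faces is exact.
Since the boundary is homogeneous, exactness can be stated for inhomogeneous chains. -/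
def IsAcyclic (A : Type*) [AddCommGroup A] (K : Set (Finset V)) : Prop :=
  ∀ f : Finset V →₀ A, ↑f.support ⊆ K → boundary f = 0 →
    ∃ g : Finset V →₀ A, ↑g.support ⊆ K ∧ boundary g = f

theorem isAcyclic_of_forall_insert_mem {K : Set (Finset V)} (u : V)
    (hK : ∀ σ ∈ K, insert u σ ∈ K) : IsAcyclic A K := by
  intro f hfK hf
  refine ⟨cone u f, fun τ hτ => ?_, ?_⟩
  · obtain ⟨σ, hσ, rfl⟩ := exists_of_mem_support_cone hτ
    exact hK σ (hfK hσ)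
  · simpa only [hf, map_zero, add_zero] using boundary_cone_add_cone_boundary u f

/-- The augmented induced subcomplex of `Δ` on the vertex set `X`: the faces of `Δ` with all
vertices in `X`, together with the empty face. -/
def facesIn {V : Type*} (Δ : PreAbstractSimplicialComplex V) (X : Set V) : Set (Finset V) :=
  {σ | (σ = ∅ ∨ σ ∈ Δ.faces) ∧ ↑σ ⊆ X}

variable {Δ : PreAbstractSimplicialComplex V} {X : Set V}

omit [LinearOrder V] in
theorem isLowerSet_facesIn : IsLowerSet (facesIn Δ X) := by
  rintro σ τ hτσ ⟨hσ, hσX⟩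
  refine ⟨τ.eq_empty_or_nonempty.imp_right fun hτ => ?_, (coe_subset.mpr hτσ).trans hσX⟩
  rcases hσ with rfl | hσ
  · exact absurd (subset_empty.mp hτσ) hτ.ne_empty
  · exact (Δ.isRelLowerSet_faces hσ).2 hτσ hτ

omit [LinearOrder V] in
theorem mem_facesIn_sdiff_singleton {σ : Finset V} {v : V} :
    σ ∈ facesIn Δ (X \ {v}) ↔ σ ∈ facesIn Δ X ∧ v ∉ σ := by
  simp only [facesIn, Set.mem_ofPred_eq, Set.subset_sdiff, Set.disjoint_singleton_right,
    mem_coe, and_assoc]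

theorem isAcyclic_facesIn_singleton {v : V} (hv : {v} ∈ Δ.faces) :
    IsAcyclic A (facesIn Δ {v}) := by
  refine isAcyclic_of_forall_insert_mem v fun σ hσ => ?_
  have : insert v σ = {v} := by
    rw [insert_eq, union_eq_left]
    exact_mod_cast hσ.2
  rw [this]
  exact ⟨Or.inr hv, (coe_singleton v).subset⟩

/-- Pushing a cycle along the cone from `u` over its part through `v` moves it off `v`. -/
theorem IsAcyclic.of_sdiff_singleton {u v : V} (huX : u ∈ X) (huv : u ≠ v)
    (hdom : ∀ σ ∈ Δ.faces, v ∈ σ → insert u σ ∈ Δ.faces)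
    (hX : IsAcyclic A (facesIn Δ (X \ {v}))) : IsAcyclic A (facesIn Δ X) := by
  intro f hfX hf
  set star := f.filter (v ∈ ·)
  set rest := f.filter (v ∉ ·)
  have star_add_rest : star + rest = f := Finsupp.filter_add_filter_not f _
  have insert_mem {σ : Finset V} (hσ : σ ∈ star.support) : insert u σ ∈ facesIn Δ X := by
    obtain ⟨hσf, hvσ⟩ := mem_filter.mp hσ
    obtain ⟨hσΔ, hσX⟩ := hfX hσf
    refine ⟨Or.inr (hdom σ (hσΔ.resolve_left (ne_empty_of_mem hvσ)) hvσ), ?_⟩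
    rw [coe_insert]
    exact Set.insert_subset huX hσX
  have notMem_of_mem_boundary {τ : Finset V} (hτ : τ ∈ (boundary star).support) : v ∉ τ := by
    have : boundary star = -boundary rest := by
      rw [eq_neg_iff_add_eq_zero, ← map_add, star_add_rest, hf]
    rw [this, Finsupp.support_neg] at hτ
    obtain ⟨σ, hσ, x, -, rfl⟩ := exists_of_mem_support_boundary hτ
    exact fun hv => (mem_filter.mp hσ).2 (mem_of_mem_erase hv)
  set pushed := rest + cone u (boundary star)
  have f_eq : f = boundary (cone u star) + pushed := by
    rw [add_left_comm, boundary_cone_add_cone_boundary, add_comm, star_add_rest]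
  have pushed_mem : ↑pushed.support ⊆ facesIn Δ (X \ {v}) := by
    intro τ hτ
    rw [mem_facesIn_sdiff_singleton]
    rcases mem_union.mp (Finsupp.support_add hτ) with hτ | hτ
    · obtain ⟨hτf, hvτ⟩ := mem_filter.mp hτ
      exact ⟨hfX hτf, hvτ⟩
    · obtain ⟨ρ, hρ, rfl⟩ := exists_of_mem_support_cone hτ
      obtain ⟨σ, hσ, x, -, rfl⟩ := exists_of_mem_support_boundary hρ
      refine ⟨isLowerSet_facesIn (insert_subset_insert u (erase_subset x σ)) (insert_mem hσ), ?_⟩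
      rw [mem_insert, not_or]
      exact ⟨huv.symm, notMem_of_mem_boundary hρ⟩
  obtain ⟨g, hgX, hg⟩ := hX pushed pushed_mem <| by
    simpa only [map_add, boundary_boundary, zero_add, hf] using (congrArg boundary f_eq).symm
  refine ⟨cone u star + g, fun τ hτ => ?_, by rw [map_add, hg, ← f_eq]⟩
  rcases mem_union.mp (Finsupp.support_add hτ) with hτ | hτ
  · obtain ⟨σ, hσ, rfl⟩ := exists_of_mem_support_cone hτ
    exact insert_mem hσ
  · exact (mem_facesIn_sdiff_singleton.mp (hgX hτ)).1

theorem IsAcyclic.of_sdiff {T : Set V} (hT : T.Finite)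
    (hdom : ∀ v ∈ T, ∃ u ∈ X \ T, ∀ σ ∈ Δ.faces, v ∈ σ → insert u σ ∈ Δ.faces)
    (hX : IsAcyclic A (facesIn Δ (X \ T))) : IsAcyclic A (facesIn Δ X) := by
  induction T, hT using Set.Finite.induction_on generalizing X with
  | empty => rwa [Set.sdiff_empty] at hX
  | @insert v T _ _ ih =>
    have sdiff_sdiff : (X \ {v}) \ T = X \ insert v T := by
      rw [Set.sdiff_sdiff, Set.singleton_union]
    obtain ⟨u, ⟨huX, huT⟩, hu⟩ := hdom v (Set.mem_insert v T)
    have huv : u ≠ v := fun h => huT (h ▸ Set.mem_insert u T)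
    refine .of_sdiff_singleton huX huv hu (ih (fun x hx => ?_) (by rwa [sdiff_sdiff]))
    rw [sdiff_sdiff]
    exact hdom x (Set.mem_insert_of_mem v hx)

end Acyclicity

section Homogenization

variable {k : Type*} [Field k] {n : ℕ} {V : Type*}

theorem mono_ne_zero (w : Fin n →₀ ℕ) : mono k w ≠ 0 :=
  monomial_eq_zero.not.mpr one_ne_zero

theorem mono_mul_mono_sub {v w : Fin n →₀ ℕ} (h : v ≤ w) :
    mono k v * mono k (w - v) = mono k w := by
  rw [mono, mono, monomial_mul, add_tsub_cancel_of_le h, mul_one, mono]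

/-- The coefficient of `x ^ w` in a chain over the polynomial ring. -/
noncomputable def coeffChain (w : Fin n →₀ ℕ) :
    (Finset V →₀ MvPolynomial (Fin n) k) →+ (Finset V →₀ k) :=
  Finsupp.mapRange.addMonoidHom (coeffAddMonoidHom w)

/-- The product of `x ^ w` and a chain over `k`. -/
noncomputable def monomialChain (w : Fin n →₀ ℕ) :
    (Finset V →₀ k) →+ (Finset V →₀ MvPolynomial (Fin n) k) :=
  Finsupp.mapRange.addMonoidHom (monomial w).toAddMonoidHom

theorem coeffChain_apply (w : Fin n →₀ ℕ) (f : Finset V →₀ MvPolynomial (Fin n) k)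
    (σ : Finset V) : coeffChain w f σ = coeff w (f σ) :=
  rfl

theorem monomialChain_single (w : Fin n →₀ ℕ) (σ : Finset V) (c : k) :
    monomialChain w (Finsupp.single σ c) = Finsupp.single σ (monomial w c) := by
  simp [monomialChain]

theorem exists_sum_monomialChain_coeffChain (f : Finset V →₀ MvPolynomial (Fin n) k) :
    ∃ T : Finset (Fin n →₀ ℕ), ∑ w ∈ T, monomialChain w (coeffChain w f) = f := by
  classical
  refine ⟨f.support.biUnion fun σ => (f σ).support, Finsupp.ext fun σ => ?_⟩
  have support_subset : (f σ).support ⊆ f.support.biUnion fun σ => (f σ).support := by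
    by_cases hσ : σ ∈ f.support
    · exact subset_biUnion_of_mem (fun σ => (f σ).support) hσ
    · rw [Finsupp.notMem_support_iff.mp hσ, support_zero]
      exact empty_subset _
  rw [Finsupp.finsetSum_apply, ← support_sum_monomial_coeff (f σ)]
  refine (sum_subset support_subset fun w _ hw => ?_).symm
  exact (congrArg (monomial w) (notMem_support_iff.mp hw)).trans (monomial_zero)

variable {t : ℕ} {Δ : PreAbstractSimplicialComplex V} (label : V → (Fin n →₀ ℕ))

/-- The linear map `e_σ ↦ M_σ σ`, which embeds the homogenized chain complex of `Δ` into the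
chain complex of the full simplex over the polynomial ring. -/
noncomputable def dehomogenize :
    Chains k n Δ t →ₗ[MvPolynomial (Fin n) k] (Finset V →₀ MvPolynomial (Fin n) k) :=
  Finsupp.linearCombination (MvPolynomial (Fin n) k) fun σ =>
    Finsupp.single σ.1 (mono k (faceLabel label σ.1))

theorem dehomogenize_single (σ : FaceOfDim Δ t) (c : MvPolynomial (Fin n) k) :
    dehomogenize label (Finsupp.single σ c) =
      Finsupp.single σ.1 (c * mono k (faceLabel label σ.1)) := by
  rw [dehomogenize, Finsupp.linearCombination_single, Finsupp.smul_single, smul_eq_mul]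

theorem dehomogenize_apply (f : Chains k n Δ t) (σ : FaceOfDim Δ t) :
    dehomogenize label f σ.1 = f σ * mono k (faceLabel label σ.1) := by
  induction f using Finsupp.induction_linear with
  | zero => rw [map_zero, Finsupp.zero_apply, Finsupp.zero_apply, zero_mul]
  | add f g hf hg => rw [map_add, Finsupp.add_apply, hf, hg, Finsupp.add_apply, add_mul]
  | single τ c =>
    classical
    rw [dehomogenize_single, Finsupp.single_apply, Finsupp.single_apply, ite_mul, zero_mul]
    simp only [Subtype.ext_iff]
    split_ifs with h
    · rw [h]
    · rfl

variable {label}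

theorem mem_faces_of_mem_support_dehomogenize {f : Chains k n Δ t} {σ : Finset V}
    (hσ : σ ∈ (dehomogenize label f).support) : σ ∈ Δ.faces ∧ #σ = t + 1 := by
  classical
  rw [dehomogenize, Finsupp.linearCombination_apply] at hσ
  obtain ⟨τ, -, hτ⟩ := mem_biUnion.mp (Finsupp.support_sum hσ)
  obtain rfl := mem_singleton.mp (Finsupp.support_single_subset (Finsupp.support_smul hτ))
  exact τ.2

variable (label) in
theorem dehomogenize_injective :
    Function.Injective (dehomogenize (k := k) (Δ := Δ) (t := t) label) := by
  intro f g h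
  ext1 σ
  refine mul_right_cancel₀ (mono_ne_zero (faceLabel label σ.1)) ?_
  rw [← dehomogenize_apply, ← dehomogenize_apply, h]

theorem of_mem_support_coeffChain_dehomogenize {w : Fin n →₀ ℕ} {f : Chains k n Δ t}
    {σ : Finset V} (hσ : σ ∈ (coeffChain w (dehomogenize label f)).support) :
    (σ ∈ Δ.faces ∧ #σ = t + 1) ∧ faceLabel label σ ≤ w := by
  rw [Finsupp.mem_support_iff, coeffChain_apply] at hσ
  have hσΔ : σ ∈ Δ.faces ∧ #σ = t + 1 :=
    mem_faces_of_mem_support_dehomogenize <| Finsupp.mem_support_iff.mpr fun h =>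
      hσ (by rw [h, coeff_zero])
  refine ⟨hσΔ, ?_⟩
  rw [dehomogenize_apply label f ⟨σ, hσΔ⟩, mono, coeff_mul_monomial'] at hσ
  by_contra hle
  exact hσ (if_neg hle)

theorem monomialChain_mem_range_dehomogenize {w : Fin n →₀ ℕ} {g : Finset V →₀ k}
    (hg : ∀ σ ∈ g.support, (σ ∈ Δ.faces ∧ #σ = t + 1) ∧ faceLabel label σ ≤ w) :
    monomialChain w g ∈ LinearMap.range (dehomogenize (k := k) (Δ := Δ) (t := t) label) := by
  rw [← Finsupp.sum_single g, Finsupp.sum, map_sum]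
  refine Submodule.sum_mem _ fun σ hσ => ?_
  obtain ⟨hσΔ, hle⟩ := hg σ hσ
  refine ⟨Finsupp.single ⟨σ, hσΔ⟩ (monomial (w - faceLabel label σ) (g σ)), ?_⟩
  rw [dehomogenize_single, monomialChain_single, mono, monomial_mul, mul_one,
    tsub_add_cancel_of_le hle]

theorem isMultihomogeneous_iff {w : Fin n →₀ ℕ} {f : Chains k n Δ t} :
    IsMultihomogeneous k label w f ↔ ∀ e ≠ w, coeffChain e (dehomogenize label f) = 0 := by
  constructor
  · intro h e hew
    ext1 σ
    by_contra hσ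
    obtain ⟨hσΔ, hle⟩ := of_mem_support_coeffChain_dehomogenize (Finsupp.mem_support_iff.mpr hσ)
    rw [coeffChain_apply, dehomogenize_apply label f ⟨σ, hσΔ⟩, mono, coeff_mul_monomial',
      if_pos hle, mul_one] at hσ
    refine hew ?_
    rw [← h ⟨σ, hσΔ⟩ _ (mem_support_iff.mpr hσ), tsub_add_cancel_of_le hle]
  · intro h σ e he
    by_contra hew
    refine mem_support_iff.mp he ?_
    have := DFunLike.congr_fun (h _ hew) σ.1
    rwa [coeffChain_apply, dehomogenize_apply, mono, coeff_mul_monomial, mul_one] at this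

theorem range_augmentation :
    LinearMap.range (augmentation k Δ label) =
      Ideal.span ((fun v => mono k (label v)) '' {v | {v} ∈ Δ.faces}) := by
  rw [augmentation, Finsupp.range_linearCombination]
  congr 1
  ext p
  constructor
  · rintro ⟨⟨σ, hσ, hcard⟩, rfl⟩
    obtain ⟨v, rfl⟩ := card_eq_one.mp hcard
    exact ⟨v, hσ, by simp only [faceLabel, sup_singleton]⟩
  · rintro ⟨v, hv, rfl⟩
    exact ⟨⟨{v}, hv, card_singleton v⟩, by simp only [faceLabel, sup_singleton]⟩

variable [LinearOrder V]

theorem boundary_dehomogenize (f : Chains k n Δ (t + 1)) :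
    boundary (dehomogenize label f) = dehomogenize label (differential k Δ label t f) := by
  induction f using Finsupp.induction_linear with
  | zero => simp only [map_zero]
  | add f g hf hg => simp only [map_add, hf, hg]
  | single σ c =>
    rw [dehomogenize_single, boundary_single, differential, Finsupp.linearCombination_single,
      map_smul, map_sum, smul_sum, ← sum_attach]
    refine sum_congr rfl fun v _ => ?_
    have hle : faceLabel label (σ.1.erase v.1) ≤ faceLabel label σ.1 :=
      sup_mono (erase_subset _ _)
    rw [dehomogenize_single, FaceOfDim.erase, mul_assoc, mul_comm (mono k _),
      mono_mul_mono_sub hle, Finsupp.smul_single, Finsupp.smul_single, vertexSign]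
    congr 1
    simp only [Units.smul_def, zsmul_eq_mul, smul_eq_mul, Units.val_pow_eq_pow_val, Units.val_neg,
      Units.val_one, Int.cast_pow, Int.cast_neg, Int.cast_one]
    ring

theorem boundary_dehomogenize_zero (f : Chains k n Δ 0) :
    boundary (dehomogenize label f) = Finsupp.single ∅ (augmentation k Δ label f) := by
  induction f using Finsupp.induction_linear with
  | zero => simp only [map_zero, Finsupp.single_zero]
  | add f g hf hg => simp only [map_add, hf, hg, Finsupp.single_add]
  | single σ c =>
    obtain ⟨σ, hσ, hcard⟩ := σ
    obtain ⟨v, rfl⟩ := card_eq_one.mp hcard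
    rw [dehomogenize_single, boundary_single, augmentation, Finsupp.linearCombination_single,
      sum_singleton, erase_singleton, smul_eq_mul, vertexSign, filter_singleton,
      if_neg (lt_irrefl v), card_empty, pow_zero, one_smul]

theorem boundary_coeffChain (w : Fin n →₀ ℕ) (f : Finset V →₀ MvPolynomial (Fin n) k) :
    boundary (coeffChain w f) = coeffChain w (boundary f) :=
  boundary_mapRange _ f

theorem boundary_monomialChain (w : Fin n →₀ ℕ) (f : Finset V →₀ k) :
    boundary (monomialChain w f) = monomialChain w (boundary f) :=
  boundary_mapRange _ f

theorem exists_boundary_dehomogenize_eq_monomialChain {w : Fin n →₀ ℕ}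
    (hΔ : IsAcyclic k (facesIn Δ {v | label v ≤ w})) {c : Finset V →₀ k}
    (hcΔ : ∀ σ ∈ c.support, (σ ∈ Δ.faces ∧ #σ = t + 1) ∧ faceLabel label σ ≤ w)
    (hc : boundary c = 0) :
    ∃ g : Chains k n Δ (t + 1), boundary (dehomogenize label g) = monomialChain w c := by
  obtain ⟨b, hbΔ, hb⟩ := hΔ c
    (fun σ hσ => ⟨.inr (hcΔ σ hσ).1.1, Finset.sup_le_iff.mp (hcΔ σ hσ).2⟩) hc
  have boundary_filter : boundary (b.filter (#· = t + 1 + 1)) = c := by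
    rw [boundary_filter_card, hb, Finsupp.filter_eq_self_iff]
    exact fun σ hσ => (hcΔ σ (Finsupp.mem_support_iff.mpr hσ)).1.2
  obtain ⟨g, hg⟩ : monomialChain w (b.filter (#· = t + 1 + 1)) ∈
      LinearMap.range (dehomogenize (Δ := Δ) (t := t + 1) label) := by
    refine monomialChain_mem_range_dehomogenize fun σ hσ => ?_
    obtain ⟨hσb, hcard⟩ := mem_filter.mp hσ
    obtain ⟨hσΔ, hσw⟩ := hbΔ hσb
    have hσ_ne : σ ≠ ∅ := (card_pos.mp (hcard ▸ Nat.succ_pos _)).ne_empty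
    exact ⟨⟨hσΔ.resolve_left hσ_ne, hcard⟩, Finset.sup_le_iff.mpr hσw⟩
  exact ⟨g, by rw [hg, boundary_monomialChain, boundary_filter]⟩

theorem exists_differential_eq
    (hΔ : ∀ w, (∃ v, {v} ∈ Δ.faces ∧ label v ≤ w) → IsAcyclic k (facesIn Δ {v | label v ≤ w}))
    {f : Chains k n Δ t} (hf : boundary (dehomogenize label f) = 0) :
    ∃ g, differential k Δ label t g = f := by
  suffices h : dehomogenize label f ∈
      LinearMap.range (dehomogenize label ∘ₗ differential k Δ label t) by
    obtain ⟨g, hg⟩ := h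
    exact ⟨g, dehomogenize_injective label hg⟩
  obtain ⟨T, hT⟩ := exists_sum_monomialChain_coeffChain (dehomogenize label f)
  rw [← hT]
  refine Submodule.sum_mem _ fun w _ => ?_
  have hfΔ {σ : Finset V} (hσ : σ ∈ (coeffChain w (dehomogenize label f)).support) :
      (σ ∈ Δ.faces ∧ #σ = t + 1) ∧ faceLabel label σ ≤ w :=
    of_mem_support_coeffChain_dehomogenize hσ
  obtain h_empty | ⟨σ, hσ⟩ :=
    (coeffChain w (dehomogenize label f)).support.eq_empty_or_nonempty
  · rw [Finsupp.support_eq_empty.mp h_empty, map_zero]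
    exact zero_mem _
  have exists_vertex : ∃ v, {v} ∈ Δ.faces ∧ label v ≤ w := by
    obtain ⟨⟨hσΔ, -⟩, hle⟩ := hfΔ hσ
    obtain ⟨⟨v, hv⟩, hsub⟩ := Δ.isRelLowerSet_faces hσΔ
    exact ⟨v, hsub (singleton_subset_iff.mpr hv) (singleton_nonempty v), (le_sup hv).trans hle⟩
  obtain ⟨g, hg⟩ := exists_boundary_dehomogenize_eq_monomialChain (hΔ w exists_vertex)
    (fun _ => hfΔ) (by rw [boundary_coeffChain, hf, map_zero])
  exact ⟨g, by rw [LinearMap.comp_apply, ← boundary_dehomogenize, hg]⟩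

theorem supportsFreeResolution_of_isAcyclic [Finite V]
    (hΔ : ∀ w, (∃ v, {v} ∈ Δ.faces ∧ label v ≤ w) → IsAcyclic k (facesIn Δ {v | label v ≤ w})) :
    SupportsFreeResolution k Δ label
      (Ideal.span ((fun v => mono k (label v)) '' {v | {v} ∈ Δ.faces})) where
  isFreeResolution :=
    { free := fun _ => inferInstance
      finite := fun _ => inferInstance
      bounded := by
        have := Fintype.ofFinite V
        refine ⟨Fintype.card V, fun t ht => ?_⟩
        have : IsEmpty (FaceOfDim Δ t) :=
          ⟨fun σ => (card_le_univ σ.1).not_gt (by rw [σ.2.2]; omega)⟩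
        infer_instance
      exact_succ := fun t f => by
        refine ⟨fun h => exists_differential_eq hΔ ?_, ?_⟩
        · rw [boundary_dehomogenize, h, map_zero]
        · rintro ⟨g, rfl⟩
          refine dehomogenize_injective label ?_
          rw [← boundary_dehomogenize, ← boundary_dehomogenize, boundary_boundary, map_zero]
      exact_zero := fun f => by
        refine ⟨fun h => exists_differential_eq hΔ ?_, ?_⟩
        · rw [boundary_dehomogenize_zero, h, Finsupp.single_zero]
        · rintro ⟨g, rfl⟩
          rw [← Finsupp.single_eq_zero (a := (∅ : Finset V)), ← boundary_dehomogenize_zero,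
            ← boundary_dehomogenize, boundary_boundary]
      range_eq := range_augmentation }
  differential_homogeneous t w f hf := by
    rw [isMultihomogeneous_iff] at hf ⊢
    intro e hew
    rw [← boundary_dehomogenize, ← boundary_coeffChain, hf e hew, map_zero]
  augmentation_homogeneous w f hf e he := by
    rw [isMultihomogeneous_iff] at hf
    by_contra hew
    have : coeffChain e (Finsupp.single (∅ : Finset V) (augmentation k Δ label f)) = 0 := by
      rw [← boundary_dehomogenize_zero, ← boundary_coeffChain, hf e hew, map_zero]
    refine mem_support_iff.mp he ?_
    simpa only [coeffChain_apply, Finsupp.single_eq_same, Finsupp.zero_apply] using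
      DFunLike.congr_fun this ∅

end Homogenization

theorem le_two_mul_half (r : ℕ) : r ≤ 2 * half r := by
  rw [half]
  omega

theorem half_lt {r : ℕ} (hr : 2 ≤ r) : half r < r := by
  rw [half]
  omega

section Points

variable {r q : ℕ}

theorem Points.coord_le (a : Points r q) (i : Fin q) : a.coord i ≤ r :=
  (single_le_sum (fun _ _ => Nat.zero_le _) (mem_univ i)).trans_eq a.sum_coord

theorem Points.coord_add_le (a : Points r q) {i j : Fin q} (hij : i ≠ j) :
    a.coord i + a.coord j ≤ r := by
  rw [← sum_pair hij]
  exact (sum_le_univ_sum_of_nonneg fun _ => Nat.zero_le _).trans_eq a.sum_coord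

instance : Finite (Points r q) :=
  .of_injective (fun a i => (⟨a.coord i, Nat.lt_succ_of_le (a.coord_le i)⟩ : Fin (r + 1)))
    fun _ _ h => Points.ext <| funext fun i => congrArg Fin.val (congrFun h i)

theorem Points.exists_one_le_coord {a b : Points r q} {i : Fin q} (ha : a.coord i = r)
    (hba : b ≠ a) : ∃ j ≠ i, 1 ≤ b.coord j := by
  by_contra! h
  have hb : b.coord i = r :=
    (Fintype.sum_eq_single i fun j hj => Nat.lt_one_iff.mp (h j hj)).symm.trans b.sum_coord
  refine hba (Points.ext <| funext fun j => ?_)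
  by_cases hj : j = i
  · rw [hj, ha, hb]
  · have := h j hj
    have := a.coord_add_le hj
    omega

theorem Points.single_le_coord {a : Points r q} {i : Fin q} {d : ℕ} (hd : d ≤ a.coord i) :
    Pi.single i d ≤ a.coord :=
  update_le_iff.mpr ⟨hd, fun _ _ => Nat.zero_le _⟩

/-- The point obtained from `a` by moving `d` units from the coordinate `i` to the coordinate
`j`. -/
def Points.move (a : Points r q) (i j : Fin q) (d : ℕ) (hd : d ≤ a.coord i) : Points r q where
  coord := a.coord - Pi.single i d + Pi.single j d
  sum_coord := by
    have hsum : ∑ l, (a.coord - Pi.single i d : Fin q → ℕ) l + d = r := by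
      simpa only [Pi.add_apply, sum_add_distrib, sum_pi_single', mem_univ, if_true, a.sum_coord]
        using congrArg (∑ l, · l) (tsub_add_cancel_of_le (Points.single_le_coord hd))
    simpa only [Pi.add_apply, sum_add_distrib, sum_pi_single', mem_univ, if_true] using hsum

theorem Points.move_coord_add_single (a : Points r q) (i j : Fin q) {d : ℕ} (hd : d ≤ a.coord i) :
    (a.move i j d hd).coord + Pi.single i d = a.coord + Pi.single j d := by
  rw [Points.move, add_right_comm, tsub_add_cancel_of_le (single_le_coord hd)]

theorem Points.move_coord_source_add (a : Points r q) {i j : Fin q} (hij : i ≠ j) {d : ℕ}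
    (hd : d ≤ a.coord i) : (a.move i j d hd).coord i + d = a.coord i := by
  simpa [hij] using congrFun (a.move_coord_add_single i j hd) i

theorem mem_base_or_exists_half_lt (a : Points r q) : a ∈ base r q ∨ ∃ i, half r < a.coord i :=
  or_iff_not_imp_right.mpr fun h i => not_lt.mp fun hi => h ⟨i, hi⟩

end Points

section Labels

variable {n r q : ℕ} {m : Fin q → (Fin n →₀ ℕ)}

theorem powerLabel_apply (a : Points r q) (x : Fin n) :
    powerLabel m a x = a.coord ⬝ᵥ fun i => m i x := by
  simp [powerLabel, Finsupp.finsetSum_apply, dotProduct]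

theorem powerLabel_move_apply (a : Points r q) (i j : Fin q) {d : ℕ} (hd : d ≤ a.coord i)
    (x : Fin n) :
    powerLabel m (a.move i j d hd) x + d * m i x = powerLabel m a x + d * m j x := by
  simpa only [powerLabel_apply, add_dotProduct, single_dotProduct] using
    congrArg (· ⬝ᵥ fun i => m i x) (a.move_coord_add_single i j hd)

theorem coord_mul_le_powerLabel (a : Points r q) (i : Fin q) (x : Fin n) :
    a.coord i * m i x ≤ powerLabel m a x := by
  rw [powerLabel_apply]
  exact single_le_sum (f := fun i => a.coord i * m i x) (fun _ _ => Nat.zero_le _) (mem_univ i)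

theorem powerLabel_add_coord_le (hm : ∀ i, IsSquarefreeMonomial (m i)) (a : Points r q)
    {i : Fin q} {x : Fin n} (hx : m i x = 0) : powerLabel m a x + a.coord i ≤ r := by
  calc powerLabel m a x + a.coord i
      = a.coord ⬝ᵥ ((fun l => m l x) + Pi.single i 1) := by
        rw [powerLabel_apply, dotProduct_add, dotProduct_single_one]
    _ ≤ ∑ l, a.coord l := sum_le_sum fun l _ => mul_le_of_le_one_right (Nat.zero_le _) ?_
    _ = r := a.sum_coord
  rcases eq_or_ne l i with rfl | hl
  · simp [hx]
  · simpa [hl] using hm l x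

theorem le_coord_add_powerLabel {a : Points r q} {i : Fin q} {x : Fin n}
    (h : ∀ l ≠ i, 1 ≤ a.coord l → 1 ≤ m l x) : r ≤ a.coord i + powerLabel m a x := by
  calc r = ∑ l, a.coord l := a.sum_coord.symm
    _ ≤ ∑ l, a.coord l * (Pi.single (M := fun _ => ℕ) i 1 l + m l x) := sum_le_sum fun l _ => ?_
    _ = a.coord ⬝ᵥ (Pi.single i 1 + fun l => m l x) := rfl
    _ = a.coord i + powerLabel m a x := by
      rw [dotProduct_add, dotProduct_single_one, powerLabel_apply]
  rcases Nat.eq_zero_or_pos (a.coord l) with hal | hal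
  · rw [hal, zero_mul]
  · refine Nat.le_mul_of_pos_right _ ?_
    rcases eq_or_ne l i with rfl | hl
    · rw [Pi.single_eq_same]
      exact Nat.add_pos_left Nat.one_pos _
    · exact Nat.add_pos_right _ (h l hl hal)

theorem exists_eq_zero_and_eq_one (hm : ∀ i, IsSquarefreeMonomial (m i)) {i j : Fin q}
    (h : ¬ m j ≤ m i) : ∃ x, m i x = 0 ∧ m j x = 1 := by
  obtain ⟨x, hx⟩ := not_forall.mp (mt Finsupp.le_def.mpr h)
  have := hm j x
  exact ⟨x, by omega, by omega⟩

theorem powerLabel_move_le_sup (hm : ∀ i, IsSquarefreeMonomial (m i)) (a b : Points r q)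
    {i j : Fin q} (hij : i ≠ j) {d : ℕ} (hd : d ≤ a.coord i)
    (hb : r + d ≤ a.coord i + b.coord j) :
    powerLabel m (a.move i j d hd) ≤ powerLabel m a ⊔ powerLabel m b := by
  intro x
  rw [Finsupp.sup_apply, le_sup_iff]
  by_cases hx : m j x ≤ m i x
  · left
    have := powerLabel_move_apply (m := m) a i j hd x
    have := Nat.mul_le_mul_left d hx
    omega
  · right
    have hxi : m i x = 0 := by
      have := hm j x
      omega
    calc powerLabel m (a.move i j d hd) x
        ≤ b.coord j * 1 := by
          have := powerLabel_add_coord_le hm (a.move i j d hd) hxi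
          have := a.move_coord_source_add hij hd
          omega
      _ ≤ b.coord j * m j x := Nat.mul_le_mul_left _ (by omega)
      _ ≤ powerLabel m b x := coord_mul_le_powerLabel b j x

section Exchange

variable (hm : ∀ i, IsSquarefreeMonomial (m i)) (hanti : Pairwise fun i j => ¬ m i ≤ m j)

include hm hanti

theorem sup_powerLabel_lt_of_le_move_left {a b c : Points r q} {i j : Fin q} (hij : i ≠ j)
    {d : ℕ} (hd : d ≤ a.coord i) (hd₀ : 0 < d) (hb : r + d ≤ a.coord i + b.coord j)
    (hc : powerLabel m c ≤ powerLabel m (a.move i j d hd)) :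
    powerLabel m c ⊔ powerLabel m b < powerLabel m a ⊔ powerLabel m b := by
  refine lt_of_le_not_ge
    (sup_le (hc.trans (powerLabel_move_le_sup hm a b hij hd hb)) le_sup_right) fun h => ?_
  obtain ⟨x, hxj, hxi⟩ := exists_eq_zero_and_eq_one hm (hanti hij)
  have hcx : powerLabel m c x < powerLabel m a x := by
    have := powerLabel_move_apply (m := m) a i j hd x
    have := hc x
    rw [hxi, hxj] at *
    omega
  have hbx : powerLabel m b x < powerLabel m a x := by
    have := powerLabel_add_coord_le hm b hxj
    have := coord_mul_le_powerLabel (m := m) a i x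
    rw [hxi] at this
    omega
  exact (max_lt hcx hbx).not_ge (le_sup_left.trans (h x))

theorem sup_powerLabel_lt_of_le_move_right {a b c : Points r q} {i j : Fin q} (hij : i ≠ j)
    {d : ℕ} (hd : d ≤ a.coord i) (hb : r + d < a.coord i + b.coord j)
    (hc : powerLabel m c ≤ powerLabel m (a.move i j d hd)) :
    powerLabel m a ⊔ powerLabel m c < powerLabel m a ⊔ powerLabel m b := by
  refine lt_of_le_not_ge
    (sup_le le_sup_left (hc.trans (powerLabel_move_le_sup hm a b hij hd hb.le))) fun h => ?_
  obtain ⟨x, hxi, hxj⟩ := exists_eq_zero_and_eq_one hm (hanti hij.symm)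
  have hbx : b.coord j ≤ powerLabel m b x := by
    simpa only [hxj, mul_one] using coord_mul_le_powerLabel (m := m) b j x
  have hax : powerLabel m a x < powerLabel m b x := by
    have := powerLabel_add_coord_le hm a hxi
    omega
  have hcx : powerLabel m c x < powerLabel m b x := by
    have := powerLabel_add_coord_le hm (a.move i j d hd) hxi
    have := a.move_coord_source_add hij hd
    have := hc x
    omega
  exact (max_lt hax hcx).not_ge (le_sup_right.trans (h x))

variable {N : Set (Points r q)} (hN : ∀ a : Points r q, ∃ c ∈ N, powerLabel m c ≤ powerLabel m a)

include hN

/-- Move the excess `aᵢ - s` to the coordinate `j` and pass to a point of `N`. Unless this point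
lies in the base, it can replace `a` or `b`, and then the lcm of the two labels decreases. -/
theorem exists_mem_base {a b : Points r q} (ha : a ∈ N) (hb : b ∈ N) {i j : Fin q} (hij : i ≠ j)
    (hai : half r < a.coord i) (hbj : half r < b.coord j) :
    ∃ c ∈ N, c ∈ base r q ∧ powerLabel m c ≤ powerLabel m a ⊔ powerLabel m b := by
  induction hw : powerLabel m a ⊔ powerLabel m b using WellFoundedLT.induction
    generalizing a b i j with
  | _ w ih =>
  subst hw
  have hr := le_two_mul_half r
  have hd : a.coord i - half r ≤ a.coord i := Nat.sub_le _ _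
  obtain ⟨c, hcN, hc⟩ := hN (a.move i j _ hd)
  rcases mem_base_or_exists_half_lt c with hcB | ⟨l, hcl⟩
  · exact ⟨c, hcN, hcB, hc.trans (powerLabel_move_le_sup hm a b hij hd (by omega))⟩
  rcases eq_or_ne i l with rfl | hil
  · have hlt := sup_powerLabel_lt_of_le_move_left hm hanti hij hd (by omega)
      (b := b) (by omega) hc
    obtain ⟨e, heN, heB, he⟩ := ih _ hlt hcN hb hij hcl hbj rfl
    exact ⟨e, heN, heB, he.trans hlt.le⟩
  · have hlt := sup_powerLabel_lt_of_le_move_right hm hanti hij hd (b := b) (by omega) hc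
    obtain ⟨e, heN, heB, he⟩ := ih _ hlt ha hcN hil hai hcl rfl
    exact ⟨e, heN, heB, he.trans hlt.le⟩

theorem exists_mem_exchange {a b : Points r q} {i l : Fin q} (hai : a.coord i = r) (hl : l ≠ i)
    (hbl : 1 ≤ b.coord l) :
    ∃ c ∈ N, c ≠ a ∧ powerLabel m c ≤ powerLabel m a ⊔ powerLabel m b ∧
      ∀ x, m i x = 0 → powerLabel m c x ≤ m l x := by
  have hd : 1 ≤ a.coord i := (hbl.trans (b.coord_le l)).trans_eq hai.symm
  have hmove := powerLabel_move_apply (m := m) a i l hd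
  obtain ⟨c, hcN, hc⟩ := hN (a.move i l 1 hd)
  refine ⟨c, hcN, ?_, hc.trans (powerLabel_move_le_sup hm a b hl.symm hd (by omega)), ?_⟩
  · rintro rfl
    obtain ⟨x, hxl, hxi⟩ := exists_eq_zero_and_eq_one hm (hanti hl.symm)
    have := hmove x
    have := hc x
    omega
  · intro x hx
    have := hmove x
    have := powerLabel_add_coord_le hm a hx
    have := hc x
    omega

/-- Choose `u ≠ a` with the least possible `lcm (mᵃ, mᵘ)`.  If `mₗ ≠ mᵢ` is a factor of `mᵘ`, then
an exchange yields a competitor of `u`; so `mᵘ` divides `mₗ` up to variables that occur in `mᵢ`.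
Some other variable divides `mₗ`.  It divides all factors of `mᵘ` except for the `mᵢ`, but it
divides `mᵘ` only once. -/
theorem exists_mem_secondLayer {w : Fin n →₀ ℕ} {a b : Points r q} {i : Fin q}
    (hai : a.coord i = r) (hba : b ≠ a) (ha : powerLabel m a ≤ w) (hb : powerLabel m b ≤ w) :
    ∃ u ∈ N, u ∈ secondLayer r q i ∧ u ≠ a ∧ powerLabel m u ≤ w := by
  obtain ⟨u, ⟨huN, hua, huw⟩, hmin⟩ := exists_minimalFor_of_wellFoundedLT
    (fun u => u ∈ N ∧ u ≠ a ∧ powerLabel m u ≤ w) (fun u => powerLabel m a ⊔ powerLabel m u) <| by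
      obtain ⟨l, hl, hbl⟩ := Points.exists_one_le_coord hai hba
      obtain ⟨c, hcN, hca, hc, -⟩ := exists_mem_exchange hm hanti hN hai hl hbl
      exact ⟨c, hcN, hca, hc.trans (sup_le ha hb)⟩
  have le_factor {l : Fin q} (hl : l ≠ i) (hul : 1 ≤ u.coord l) {x : Fin n} (hx : m i x = 0) :
      powerLabel m u x ≤ m l x := by
    obtain ⟨c, hcN, hca, hc, hcl⟩ := exists_mem_exchange hm hanti hN hai hl hul
    have hle := hmin ⟨hcN, hca, hc.trans (sup_le ha huw)⟩ (sup_le le_sup_left hc) x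
    have hax : powerLabel m a x = 0 := by
      have := powerLabel_add_coord_le hm a hx
      omega
    simp only [Finsupp.sup_apply, hax, zero_max] at hle
    exact hle.trans (hcl x hx)
  obtain ⟨l, hl, hul⟩ := Points.exists_one_le_coord hai hua
  obtain ⟨x, hxi, hxl⟩ := exists_eq_zero_and_eq_one hm (hanti hl)
  have one_le : 1 ≤ powerLabel m u x :=
    hul.trans (by simpa only [hxl, mul_one] using coord_mul_le_powerLabel (m := m) u l x)
  have le_one : powerLabel m u x ≤ 1 := (le_factor hl hul hxi).trans_eq hxl
  have r_le : r ≤ u.coord i + powerLabel m u x :=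
    le_coord_add_powerLabel fun l' hl' hul' => one_le.trans (le_factor hl' hul' hxi)
  exact ⟨u, huN, Nat.sub_le_iff_le_add.mpr (r_le.trans (by omega)), hua, huw⟩

end Exchange

end Labels

section Faces

variable {r q : ℕ}

/-- A vertex `r eᵢ` of the simplex of all points, where `r ≥ 2`. These points are exactly the ones
that lie in no `Fᵢ`. -/
def IsCorner (a : Points r q) : Prop :=
  2 ≤ r ∧ ∃ i, a.coord i = r

theorem mem_firstLayer_of_half_lt {a : Points r q} {i : Fin q} (ha : ¬ IsCorner a)
    (hi : half r < a.coord i) : a ∈ firstLayer r q i := by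
  have hr := le_two_mul_half r
  refine ⟨?_, fun j hj => ?_⟩
  · have hle := a.coord_le i
    by_cases hr₂ : 2 ≤ r
    · have hne : a.coord i ≠ r := fun h => ha ⟨hr₂, i, h⟩
      exact le_max_of_le_left (by omega)
    · exact le_max_of_le_right (by omega)
  · have := a.coord_add_le hj
    omega

theorem mem_firstLayer_of_mem_base {a : Points r q} (ha : a ∈ base r q) (i : Fin q) :
    a ∈ firstLayer r q i :=
  ⟨le_max_of_le_right (ha i), fun j _ => ha j⟩

theorem not_isCorner_of_mem_base {a : Points r q} (ha : a ∈ base r q) : ¬ IsCorner a := by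
  rintro ⟨hr, i, hi⟩
  exact (hi.symm.trans_le (ha i)).not_gt (half_lt hr)

theorem mem_firstLayer_of_mem_secondLayer {a : Points r q} {i : Fin q} (ha : ¬ IsCorner a)
    (hi : a ∈ secondLayer r q i) : a ∈ firstLayer r q i := by
  by_cases h : half r < a.coord i
  · exact mem_firstLayer_of_half_lt ha h
  · have hi' : r - 1 ≤ a.coord i := hi
    refine mem_firstLayer_of_mem_base (fun j => ?_) i
    rcases eq_or_ne j i with rfl | hj
    · exact not_lt.mp h
    · have := a.coord_add_le hj
      have := le_two_mul_half r
      omega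

theorem not_mem_firstLayer_of_isCorner {a : Points r q} (ha : IsCorner a) (j : Fin q) :
    a ∉ firstLayer r q j := by
  rintro ⟨hj, hne⟩
  obtain ⟨hr, i, hi⟩ := ha
  have := half_lt hr
  rcases eq_or_ne i j with rfl | hij
  · rcases le_max_iff.mp hj with h | h <;> omega
  · have := hne i hij
    omega

theorem eq_of_mem_secondLayer {a : Points r q} {i j : Fin q} (hr : 2 ≤ r) (hai : a.coord i = r)
    (haj : a ∈ secondLayer r q j) : i = j := by
  by_contra hij
  have haj' : r - 1 ≤ a.coord j := haj
  have := a.coord_add_le hij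
  omega

theorem subset_secondLayer_of_coord_eq {σ : Finset (Points r q)} (hσ : σ ∈ (complexL r q).faces)
    {a : Points r q} {i : Fin q} (hr : 2 ≤ r) (hai : a.coord i = r) (haσ : a ∈ σ) :
    (σ : Set (Points r q)) ⊆ secondLayer r q i := by
  obtain ⟨-, j, h | h⟩ := hσ
  · exact absurd (h haσ) (not_mem_firstLayer_of_isCorner ⟨hr, i, hai⟩ j)
  · rwa [eq_of_mem_secondLayer hr hai (h haσ)]

theorem not_isCorner_of_mem_secondLayer {a u : Points r q} {i : Fin q} (hai : a.coord i = r)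
    (hui : u ∈ secondLayer r q i) (hua : u ≠ a) : ¬ IsCorner u := by
  rintro ⟨hr, j, huj⟩
  obtain rfl := eq_of_mem_secondLayer hr huj hui
  obtain ⟨l, hl, hul⟩ := Points.exists_one_le_coord hai hua
  have := u.coord_add_le hl
  omega

theorem singleton_mem_faces (hq : 1 ≤ q) (a : Points r q) : {a} ∈ (complexL r q).faces := by
  refine ⟨singleton_nonempty a, ?_⟩
  simp only [coe_singleton, Set.singleton_subset_iff]
  by_cases hc : IsCorner a
  · obtain ⟨-, i, hi⟩ := hc
    exact ⟨i, .inr ((Nat.sub_le r 1).trans_eq hi.symm)⟩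
  · rcases mem_base_or_exists_half_lt a with hB | ⟨i, hi⟩
    · exact ⟨⟨0, hq⟩, .inl (mem_firstLayer_of_mem_base hB _)⟩
    · exact ⟨i, .inl (mem_firstLayer_of_half_lt hc hi)⟩

theorem insert_mem_faces_of_mem_secondLayer {σ : Finset (Points r q)} [DecidableEq (Points r q)]
    (hσ : σ ∈ (complexL r q).faces) {a u : Points r q} {i : Fin q} (hr : 2 ≤ r)
    (hai : a.coord i = r) (haσ : a ∈ σ) (hu : u ∈ secondLayer r q i) :
    insert u σ ∈ (complexL r q).faces := by
  refine ⟨insert_nonempty u σ, i, .inr ?_⟩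
  rw [coe_insert]
  exact Set.insert_subset hu (subset_secondLayer_of_coord_eq hσ hr hai haσ)

theorem insert_mem_faces_of_mem_base {σ : Finset (Points r q)} [DecidableEq (Points r q)]
    (hσ : σ ∈ (complexL r q).faces) (hcorner : ∀ a ∈ σ, ¬ IsCorner a) {u : Points r q}
    (hu : u ∈ base r q) : insert u σ ∈ (complexL r q).faces := by
  obtain ⟨-, i, h⟩ := hσ
  refine ⟨insert_nonempty u σ, i, .inl ?_⟩
  rw [coe_insert]
  refine Set.insert_subset (mem_firstLayer_of_mem_base hu i) fun a ha => ?_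
  exact h.elim (· ha) fun h => mem_firstLayer_of_mem_secondLayer (hcorner a ha) (h ha)

end Faces

section AcyclicityOfFaces

variable {A : Type*} [AddCommGroup A] {r q : ℕ} [LinearOrder (Points r q)] {X : Set (Points r q)}

theorem isAcyclic_facesIn_of_mem_base (hq : 1 ≤ q) (hX : ∀ a ∈ X, ¬ IsCorner a)
    {u : Points r q} (huX : u ∈ X) (hu : u ∈ base r q) :
    IsAcyclic A (facesIn (complexL r q) X) := by
  refine isAcyclic_of_forall_insert_mem u fun σ ⟨hσ, hσX⟩ => ⟨.inr ?_, ?_⟩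
  · rcases hσ with rfl | hσ
    · exact singleton_mem_faces hq u
    · exact insert_mem_faces_of_mem_base hσ (fun a ha => hX a (hσX ha)) hu
  · rw [coe_insert]
    exact Set.insert_subset huX hσX

theorem isAcyclic_facesIn_of_subset_firstLayer (hX : X.Nonempty) {i : Fin q}
    (hi : X ⊆ firstLayer r q i) : IsAcyclic A (facesIn (complexL r q) X) := by
  obtain ⟨u, hu⟩ := hX
  refine isAcyclic_of_forall_insert_mem u fun σ ⟨_, hσX⟩ => ?_
  have hins : (↑(insert u σ) : Set (Points r q)) ⊆ X := by
    rw [coe_insert]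
    exact Set.insert_subset hu hσX
  exact ⟨.inr ⟨insert_nonempty u σ, i, .inl (hins.trans hi)⟩, hins⟩

theorem isAcyclic_facesIn_of_forall_not_isCorner (hq : 1 ≤ q) (hne : X.Nonempty)
    (hX : ∀ a ∈ X, ¬ IsCorner a)
    (hbase : ∀ a ∈ X, ∀ b ∈ X, ∀ i j, i ≠ j → half r < a.coord i → half r < b.coord j →
      ∃ c ∈ X, c ∈ base r q) :
    IsAcyclic A (facesIn (complexL r q) X) := by
  by_cases hB : ∃ u ∈ X, u ∈ base r q
  · obtain ⟨u, huX, hu⟩ := hB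
    exact isAcyclic_facesIn_of_mem_base hq hX huX hu
  have half_lt_of_mem {a : Points r q} (ha : a ∈ X) : ∃ i, half r < a.coord i :=
    (mem_base_or_exists_half_lt a).resolve_left fun h => hB ⟨a, ha, h⟩
  obtain ⟨a, ha⟩ := hne
  obtain ⟨i, hi⟩ := half_lt_of_mem ha
  refine isAcyclic_facesIn_of_subset_firstLayer (i := i) ⟨a, ha⟩ fun b hb => ?_
  obtain ⟨j, hj⟩ := half_lt_of_mem hb
  obtain rfl : i = j := by_contra fun hij => hB (hbase a ha b hb i j hij hi hj)
  exact mem_firstLayer_of_half_lt (hX b hb) hj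

theorem isAcyclic_facesIn_of_exchange (hq : 1 ≤ q) (hne : X.Nonempty)
    (hbase : ∀ a ∈ X, ∀ b ∈ X, ∀ i j, i ≠ j → half r < a.coord i → half r < b.coord j →
      ∃ c ∈ X, c ∈ base r q)
    (hcorner : ∀ a ∈ X, ∀ b ∈ X, b ≠ a → ∀ i, a.coord i = r →
      ∃ u ∈ X, u ∈ secondLayer r q i ∧ u ≠ a) :
    IsAcyclic A (facesIn (complexL r q) X) := by
  obtain ⟨a, rfl⟩ | hnt := hne.exists_eq_singleton_or_nontrivial
  · exact isAcyclic_facesIn_singleton (singleton_mem_faces hq a)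
  set T := {a | a ∈ X ∧ IsCorner a}
  have exists_dominating {a : Points r q} (ha : a ∈ X) {i : Fin q} (hai : a.coord i = r) :
      ∃ u ∈ X \ T, u ∈ secondLayer r q i := by
    obtain ⟨b, hb, hba⟩ := hnt.exists_ne a
    obtain ⟨u, huX, hui, hua⟩ := hcorner a ha b hb hba i hai
    exact ⟨u, ⟨huX, fun hu => not_isCorner_of_mem_secondLayer hai hui hua hu.2⟩, hui⟩
  have sdiff_nonempty : (X \ T).Nonempty := by
    obtain ⟨a, ha⟩ := hne
    by_cases haT : a ∈ T
    · obtain ⟨-, -, i, hai⟩ := haT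
      exact (exists_dominating ha hai).imp fun _ hu => hu.1
    · exact ⟨a, ha, haT⟩
  refine .of_sdiff T.toFinite ?_ ?_
  · rintro a ⟨haX, hr, i, hai⟩
    obtain ⟨u, hu, hui⟩ := exists_dominating haX hai
    exact ⟨u, hu, fun σ hσ haσ => insert_mem_faces_of_mem_secondLayer hσ hr hai haσ hui⟩
  · refine isAcyclic_facesIn_of_forall_not_isCorner hq sdiff_nonempty
      (fun a ha hc => ha.2 ⟨ha.1, hc⟩) fun a ha b hb i j hij hai hbj => ?_
    obtain ⟨c, hcX, hcB⟩ := hbase a ha.1 b hb.1 i j hij hai hbj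
    exact ⟨c, ⟨hcX, fun hc => not_isCorner_of_mem_base hcB hc.2⟩, hcB⟩

end AcyclicityOfFaces

section Powers

variable {k : Type*} [Field k] {n r q : ℕ} {m : Fin q → (Fin n →₀ ℕ)}

theorem mono_powerLabel (a : Points r q) :
    mono k (powerLabel m a) = ∏ i, mono k (m i) ^ a.coord i := by
  simp only [mono, powerLabel, monomial_sum_one, monomial_pow, one_pow]

theorem range_pow_eq {M : Type*} [CommMonoid M] (g : Fin q → M) :
    Set.range g ^ r = Set.range fun a : Points r q => ∏ i, g i ^ a.coord i := by
  refine Set.Subset.antisymm ?_ ?_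
  · intro p hp
    obtain ⟨f, rfl⟩ := Set.mem_pow.mp hp
    choose φ hφ using fun x => (f x).2
    refine ⟨⟨fun i => #{x | φ x = i}, ?_⟩, ?_⟩
    · rw [← card_eq_sum_card_fiberwise fun x _ => mem_univ (φ x), card_univ, Fintype.card_fin]
    · simpa only [List.prod_ofFn, ← hφ, prod_const] using prod_fiberwise' univ φ g
  · rintro _ ⟨a, rfl⟩
    have h : ∏ i, g i ^ a.coord i ∈ ∏ i, Set.range g ^ a.coord i :=
      Set.finsetProd_mem_finsetProd _ _ _ fun i _ => Set.pow_mem_pow (Set.mem_range_self i)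
    rwa [prod_pow_eq_pow_sum, a.sum_coord] at h

theorem pow_eq_span_powerLabel {I : Ideal (MvPolynomial (Fin n) k)}
    (hI : Ideal.span (Set.range fun i => mono k (m i)) = I) :
    I ^ r = Ideal.span (Set.range fun a : Points r q => mono k (powerLabel m a)) := by
  simp only [mono_powerLabel]
  rw [← hI, ← range_pow_eq]
  exact Submodule.span_pow _ r

theorem span_mono_image_eq_of_forall_exists_le {V : Type*} {label : V → (Fin n →₀ ℕ)} {N : Set V}
    (hN : ∀ v, ∃ c ∈ N, label c ≤ label v) :
    Ideal.span ((fun v => mono k (label v)) '' N) =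
      Ideal.span (Set.range fun v => mono k (label v)) := by
  refine le_antisymm (Ideal.span_mono (Set.image_subset_range _ _)) (Ideal.span_le.mpr ?_)
  rintro _ ⟨v, rfl⟩
  obtain ⟨c, hc, hcv⟩ := hN v
  beta_reduce
  rw [← mono_mul_mono_sub hcv]
  exact Ideal.mul_mem_right _ _ (Ideal.subset_span ⟨c, hc, rfl⟩)

theorem IsMinimallyGeneratedBy.pairwise_not_le {I : Ideal (MvPolynomial (Fin n) k)}
    (hI : IsMinimallyGeneratedBy I fun i => mono k (m i)) :
    Pairwise fun i j => ¬ m i ≤ m j := by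
  intro i j hij hle
  refine (hI.2 {j}ᶜ ?_).symm.subset (Set.mem_univ j) rfl
  refine (span_mono_image_eq_of_forall_exists_le fun l => ?_).trans hI.1
  rcases eq_or_ne l j with rfl | hl
  · exact ⟨i, hij, hle⟩
  · exact ⟨l, hl, le_rfl⟩

theorem inducedSubcomplex_univ {V : Type*} (Δ : PreAbstractSimplicialComplex V) :
    inducedSubcomplex Δ Set.univ = Δ := by
  ext σ
  exact and_iff_left (Set.subset_univ _)

theorem facesIn_inducedSubcomplex {V : Type*} (Δ : PreAbstractSimplicialComplex V) (N X : Set V) :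
    facesIn (inducedSubcomplex Δ N) X = facesIn Δ (N ∩ X) := by
  ext σ
  rcases σ.eq_empty_or_nonempty with rfl | hσ
  · simp [facesIn]
  · simp [facesIn, inducedSubcomplex, hσ.ne_empty, and_assoc]

theorem setOf_singleton_mem_faces_inducedSubcomplex (hq : 1 ≤ q) (N : Set (Points r q)) :
    {a | {a} ∈ (inducedSubcomplex (complexL r q) N).faces} = N := by
  ext a
  refine (and_iff_right (singleton_mem_faces hq a)).trans ?_
  rw [coe_singleton, Set.singleton_subset_iff]

theorem exists_mem_nonredundant_le {C : Set (Points r q)} (hC : IsRepresentativeSet m C)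
    (a : Points r q) : ∃ c ∈ nonredundant m C, powerLabel m c ≤ powerLabel m a := by
  obtain ⟨c₀, ⟨hc₀, hc₀a⟩, -⟩ := hC.existsUnique a
  obtain ⟨c, ⟨hc, hca⟩, hmin⟩ := exists_minimalFor_of_wellFoundedLT
    (fun c => c ∈ C ∧ powerLabel m c ≤ powerLabel m a) (powerLabel m) ⟨c₀, hc₀, hc₀a.le⟩
  refine ⟨c, ⟨hc, ?_⟩, hca⟩
  rintro ⟨c', hc', hne, hle⟩
  exact hne <| (hC.existsUnique c).unique
    ⟨hc', hle.antisymm (hmin ⟨hc', hle.trans hca⟩ hle)⟩ ⟨hc, rfl⟩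

theorem isAcyclic_facesIn_label_le {A : Type*} [AddCommGroup A] [LinearOrder (Points r q)]
    (hq : 1 ≤ q) (hm : ∀ i, IsSquarefreeMonomial (m i)) (hanti : Pairwise fun i j => ¬ m i ≤ m j)
    {N : Set (Points r q)} (hN : ∀ a : Points r q, ∃ c ∈ N, powerLabel m c ≤ powerLabel m a)
    {w : Fin n →₀ ℕ} (hw : ∃ a ∈ N, powerLabel m a ≤ w) :
    IsAcyclic A (facesIn (complexL r q) (N ∩ {a | powerLabel m a ≤ w})) := by
  refine isAcyclic_facesIn_of_exchange hq hw ?_ ?_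
  · rintro a ⟨haN, haw⟩ b ⟨hbN, hbw⟩ i j hij hai hbj
    obtain ⟨c, hcN, hcB, hc⟩ := exists_mem_base hm hanti hN haN hbN hij hai hbj
    exact ⟨c, ⟨hcN, hc.trans (sup_le haw hbw)⟩, hcB⟩
  · rintro a ⟨-, haw⟩ b ⟨-, hbw⟩ hba i hai
    obtain ⟨u, huN, hui, hua, huw⟩ := exists_mem_secondLayer hm hanti hN hai hba haw hbw
    exact ⟨u, ⟨huN, huw⟩, hui, hua⟩

end Powers

end PowerResolution

open PowerResolution in
theorem theorem5p7_general {k : Type*} [Field k] {n q r : ℕ} (hq : 1 ≤ q)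
    [LinearOrder (Points r q)] (I : Ideal (MvPolynomial (Fin n) k)) (m : Fin q → (Fin n →₀ ℕ))
    (hm : ∀ i, IsSquarefreeMonomial (m i)) (hI : IsMinimallyGeneratedBy I fun i => mono k (m i))
    (N : Set (Points r q)) (hN : ∀ a : Points r q, ∃ c ∈ N, powerLabel m c ≤ powerLabel m a) :
    SupportsFreeResolution k (inducedSubcomplex (complexL r q) N) (powerLabel m) (I ^ r) := by
  have vertices := setOf_singleton_mem_faces_inducedSubcomplex hq N
  have pow_eq_span : I ^ r = Ideal.span ((fun a => mono k (powerLabel m a)) ''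
      {a | {a} ∈ (inducedSubcomplex (complexL r q) N).faces}) := by
    rw [vertices, span_mono_image_eq_of_forall_exists_le hN, pow_eq_span_powerLabel hI.1]
  rw [pow_eq_span]
  refine supportsFreeResolution_of_isAcyclic fun w ⟨a, ha, haw⟩ => ?_
  rw [facesIn_inducedSubcomplex]
  exact isAcyclic_facesIn_label_le hq hm hI.pairwise_not_le hN ⟨a, vertices.subset ha, haw⟩

theorem theorem5p7 {k : Type*} [Field k] {n q r : ℕ} (hq : 1 ≤ q) (hr : 1 ≤ r)
    [LinearOrder (PowerResolution.Points r q)]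
    (I : Ideal (MvPolynomial (Fin n) k)) (m : Fin q → (Fin n →₀ ℕ))
    (hm : ∀ i, PowerResolution.IsSquarefreeMonomial (m i))
    (hI : PowerResolution.IsMinimallyGeneratedBy I (fun i => PowerResolution.mono k (m i))) :
    PowerResolution.SupportsFreeResolution k (PowerResolution.complexL r q)
        (PowerResolution.powerLabel m) (I ^ r) ∧
      ∀ C : Set (PowerResolution.Points r q), PowerResolution.IsRepresentativeSet m C →
        PowerResolution.SupportsFreeResolution k (PowerResolution.complexLOf m C)
          (PowerResolution.powerLabel m) (I ^ r) :=
  ⟨PowerResolution.inducedSubcomplex_univ (PowerResolution.complexL r q) ▸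
      theorem5p7_general hq I m hm hI Set.univ fun a => ⟨a, Set.mem_univ a, le_rfl⟩,
    fun _ hC => theorem5p7_general hq I m hm hI _ (PowerResolution.exists_mem_nonredundant_le hC)⟩
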